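/- Let $\mathcal N$ be an infinite set of names. Pure processes of (finite, communication-free) mobile ambients are $$P ::= \mathbf 0 \mid n[P] \mid M.P \mid (\nu n)P \mid P_1|P_2,\qquad M ::= in\ n \mid out\ n \mid open\ n,$$ where $(\nu n)$ binds $n$ and $fn(P)$ is the set of free names. Structural congruence $\equiv$ is the least equivalence on pure processes that is preserved by $-|R$, $(\nu n)-$, $n[-]$ and $M.-$ and satisfies: $|$ is commutative and associative, $P|\mathbf 0\equiv P$, $(\nu n)(\nu m)P\equiv(\nu m)(\nu n)P$, $(\nu n)(P|Q)\equiv P|(\nu n)Q$ if $n\notin fn(P)$, $(\nu n)m[P]\equiv m[(\nu n)P]$ if $n\ne m$, $(\nu n)M.P\equiv M.(\nu n)P$ if $n\notin fn(M)$, and $(\nu n)P\equiv(\nu m)(P\{m/n\})$ if $m\notin fn(P)$. Reduction $\rightsquigarrow$ is the smallest relation closed under $\equiv$, $(\nu n)-$, $n[-]$ and $-|R$ with $$n[in\ m.P|Q]\,|\,m[R]\rightsquigarrow m[n[P|Q]|R],\quad m[n[out\ m.P|Q]|R]\rightsquigarrow n[P|Q]\,|\,m[R],\quad open\ n.P\,|\,n[Q]\rightsquigarrow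 P|Q.$$ Write $P\downarrow n$ if $P\equiv(\nu A)(n[Q]|R)$ for some processes $Q,R$ and some finite set $A$ of names with $n\notin A$. A context $C[-]$ is a pure process with one hole (filling the hole may capture names). A symmetric relation $\mathcal R$ is a barbed saturated bisimulation if $P\,\mathcal R\,Q$ implies, for every context $C[-]$: (i) for every name $o$, if $C[P]\downarrow o$ then $C[Q]\downarrow o$; (ii) if $C[P]\rightsquigarrow P'$ then $C[Q]\rightsquigarrow Q'$ and $P'\,\mathcal R\,Q'$ for some $Q'$. Barbed saturated bisimilarity $\sim^{BS}_M$ is the largest such relation. The LTS $M$ has the following transitions from a pure process $P$, labelled by contexts with process variables $X_1,X_2$ and a name variable $x$, where $A$ is a finite set of names: * (Tau) if $P\rightsquigarrow Q$: label $-$, target $Q$; * (In) if $P\equiv(\nu A)(in\ m.P_1|P_2)$, $m\notin A$: label $x[-|X_1]\,|\,m[X_2]$, target $(\nu A)m[x[P_1|P_2|X_1]|X_2]$; * (InAmb) if $P\equiv(\nu A)(n[in\ m.P_1|P_2]|P_3)$, $m\notin A$: label $-|m[X_1]$, target $(\nu A)(m[n[P_1|P_2]|X_1]|P_3)$; * (CoIn)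 if $P\equiv(\nu A)(m[P_1]|P_2)$, $m\notin A$: label $-|x[in\ m.X_1|X_2]$, target $(\nu A)(m[x[X_1|X_2]|P_1]|P_2)$; * (Out) if $P\equiv(\nu A)(out\ m.P_1|P_2)$, $m\notin A$: label $m[x[-|X_1]|X_2]$, target $(\nu A)(m[X_2]|x[P_1|P_2|X_1])$; * (OutAmb) if $P\equiv(\nu A)(n[out\ m.P_1|P_2]|P_3)$, $m\notin A$: label $m[-|X_1]$, target $(\nu A)(m[P_3|X_1]|n[P_1|P_2])$; * (Open) if $P\equiv(\nu A)(open\ n.P_1|P_2)$, $n\notin A$: label $-|n[X_1]$, target $(\nu A)(P_1|P_2|X_1)$; * (CoOpen) if $P\equiv(\nu A)(n[P_1]|P_2)$, $n\notin A$: label $-|open\ n.X_1$, target $(\nu A)(P_1|X_1|P_2)$. The LTS $M_I$ consists of the instances of these: $P\xrightarrow{C[-]}_{M_I}Q$ if there are a transition of $M$ from $P$ with label $C_\epsilon[-]$ and target $Q_\epsilon$, and a capture-avoiding substitution $\sigma$ of pure processes for the process variables and of names for the name variable, such that $C_\epsilon[-]\sigma=C[-]$ and $Q_\epsilon\sigma\equiv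 Q$. **Lemma.** Let $n$ be a name and $T_1$ a pure process. For pure processes $X,Y$ let $\mathcal P(X,Y)$ hold if there are a process $P''$ and a name $m\notin fn(X)$ such that $$X\,|\,open\ n.(m[\mathbf 0]\,|\,open\ m.T_1)\rightsquigarrow P''\rightsquigarrow Y,\qquad P''\downarrow m,\qquad Y\not\downarrow m.$$ Then: 1. $\mathcal P$ is stable under $\sim^{BS}_M$: whenever $P\sim^{BS}_M Q$ and $\mathcal P(P,P')$, there is $Q'$ with $\mathcal P(Q,Q')$ and $P'\sim^{BS}_M Q'$. 2. For all pure processes $P,P'$: $\mathcal P(P,P')$ if and only if $P\xrightarrow{-|open\ n.T_1}_{M_I}P'$. -/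

import Mathlib

/-! Finite, communication-free mobile ambients over a set `N` of names. -/

namespace MA

/-- Capabilities `in n`, `out n`, `open n`. -/
inductive Cap (N : Type*) where
  | goIn (n : N)
  | goOut (n : N)
  | opn (n : N)

/-- Pure processes: `0`, `n[P]`, `M.P`, `(ν n)P`, `P | Q`. -/
inductive Proc (N : Type*) where
  | nil
  | amb (n : N) (P : Proc N)
  | act (M : Cap N) (P : Proc N)
  | res (n : N) (P : Proc N)
  | par (P Q : Proc N)

/-- Extended processes: also process variables `X` and ambients `x[P]` named by a name variable.
Process variables and name variables are indexed by `ℕ`. -/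
inductive XProc (N : Type*) where
  | nil
  | amb (n : N) (P : XProc N)
  | act (M : Cap N) (P : XProc N)
  | res (n : N) (P : XProc N)
  | par (P Q : XProc N)
  | pvar (X : ℕ)
  | vamb (x : ℕ) (P : XProc N)

section

variable {N : Type*}

def Cap.name : Cap N → N
  | .goIn n => n
  | .goOut n => n
  | .opn n => n

def Cap.map (f : N → N) : Cap N → Cap N
  | .goIn n => .goIn (f n)
  | .goOut n => .goOut (f n)
  | .opn n => .opn (f n)

/-- Apply `f` to every name of a process, binders and bound names included. -/
def Proc.map (f : N → N) : Proc N → Proc N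
  | .nil => .nil
  | .amb n P => .amb (f n) (P.map f)
  | .act M P => .act (M.map f) (P.map f)
  | .res n P => .res (f n) (P.map f)
  | .par P Q => .par (P.map f) (Q.map f)

/-- `(ν A)P` for a finite list `A` of names. -/
def Proc.resAll (A : List N) (P : Proc N) : Proc N := A.foldr Proc.res P

def XProc.resAll (A : List N) (P : XProc N) : XProc N := A.foldr XProc.res P

/-- A pure process seen as an extended process. -/
def Proc.toX : Proc N → XProc N
  | .nil => .nil
  | .amb n P => .amb n P.toX
  | .act M P => .act M P.toX
  | .res n P => .res n P.toX
  | .par P Q => .par P.toX Q.toX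

variable [DecidableEq N]

/-- Free names of a pure process. -/
def Proc.fn : Proc N → Finset N
  | .nil => ∅
  | .amb n P => insert n P.fn
  | .act M P => insert M.name P.fn
  | .res n P => P.fn.erase n
  | .par P Q => P.fn ∪ Q.fn

/-- Free names of an extended process; variables contribute none. -/
def XProc.fn : XProc N → Finset N
  | .nil => ∅
  | .amb n P => insert n P.fn
  | .act M P => insert M.name P.fn
  | .res n P => P.fn.erase n
  | .par P Q => P.fn ∪ Q.fn
  | .pvar _ => ∅
  | .vamb _ P => P.fn

/-- Structural congruence. In `alpha`, the process `P{m/n}` is written as `P` with the names `n`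
and `m` exchanged everywhere: for `m` not free in `P` this is capture-avoiding renaming of `n`
to `m`, up to the names of inner binders. -/
inductive StrCong : Proc N → Proc N → Prop
  | refl (P) : StrCong P P
  | symm {P Q} : StrCong P Q → StrCong Q P
  | trans {P Q R} : StrCong P Q → StrCong Q R → StrCong P R
  | par {P Q} (R) : StrCong P Q → StrCong (.par P R) (.par Q R)
  | res {P Q} (n) : StrCong P Q → StrCong (.res n P) (.res n Q)
  | amb {P Q} (n) : StrCong P Q → StrCong (.amb n P) (.amb n Q)
  | act {P Q} (M) : StrCong P Q → StrCong (.act M P) (.act M Q)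
  | par_comm (P Q) : StrCong (.par P Q) (.par Q P)
  | par_assoc (P Q R) : StrCong (.par (.par P Q) R) (.par P (.par Q R))
  | par_nil (P) : StrCong (.par P .nil) P
  | res_comm (n m P) : StrCong (.res n (.res m P)) (.res m (.res n P))
  | res_par (n P Q) : n ∉ P.fn → StrCong (.res n (.par P Q)) (.par P (.res n Q))
  | res_amb (n m P) : n ≠ m → StrCong (.res n (.amb m P)) (.amb m (.res n P))
  | res_act (n M P) : n ≠ M.name → StrCong (.res n (.act M P)) (.act M (.res n P))
  | alpha (n m P) : m ∉ P.fn → StrCong (.res n P) (.res m (P.map (Equiv.swap n m)))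

/-- The reduction relation `P ⇝ Q`. -/
inductive Red : Proc N → Proc N → Prop
  | goIn (n m P Q R) :
      Red (.par (.amb n (.par (.act (.goIn m) P) Q)) (.amb m R))
        (.amb m (.par (.amb n (.par P Q)) R))
  | goOut (n m P Q R) :
      Red (.amb m (.par (.amb n (.par (.act (.goOut m) P) Q)) R))
        (.par (.amb n (.par P Q)) (.amb m R))
  | opn (n P Q) : Red (.par (.act (.opn n) P) (.amb n Q)) (.par P Q)
  | res {P Q} (n) : Red P Q → Red (.res n P) (.res n Q)
  | amb {P Q} (n) : Red P Q → Red (.amb n P) (.amb n Q)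
  | par {P Q} (R) : Red P Q → Red (.par P R) (.par Q R)
  | congr {P P' Q' Q} : StrCong P P' → Red P' Q' → StrCong Q' Q → Red P Q

/-- The barb `P ↓ n`: there is an unrestricted ambient `n` at top level. -/
def Barb (P : Proc N) (n : N) : Prop :=
  ∃ (A : List N) (Q R : Proc N), n ∉ A ∧ StrCong P (.resAll A (.par (.amb n Q) R))

end

/-- Pure unary contexts: pure processes with exactly one hole. -/
inductive Ctx (N : Type*) where
  | hole
  | amb (n : N) (C : Ctx N)
  | act (M : Cap N) (C : Ctx N)
  | res (n : N) (C : Ctx N)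
  | parL (C : Ctx N) (R : Proc N)
  | parR (R : Proc N) (C : Ctx N)

/-- Extended unary contexts. The hole is never below a restriction: this covers all labels of the
transition system `TransM`. -/
inductive XCtx (N : Type*) where
  | hole
  | amb (n : N) (C : XCtx N)
  | vamb (x : ℕ) (C : XCtx N)
  | act (M : Cap N) (C : XCtx N)
  | parL (C : XCtx N) (R : XProc N)
  | parR (R : XProc N) (C : XCtx N)

/-- A substitution of pure processes for process variables and of names for name variables. -/
structure Subst (N : Type*) where
  proc : ℕ → Proc N
  name : ℕ → N

section

variable {N : Type*}

/-- `C[P]`; the hole is filled literally, so restrictions of `C` bind free names of `P`. -/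
def Ctx.fill : Ctx N → Proc N → Proc N
  | .hole, P => P
  | .amb n C, P => .amb n (C.fill P)
  | .act M C, P => .act M (C.fill P)
  | .res n C, P => .res n (C.fill P)
  | .parL C R, P => .par (C.fill P) R
  | .parR R C, P => .par R (C.fill P)

/-- The process variables of an extended process. -/
def XProc.pvars : XProc N → Finset ℕ
  | .nil => ∅
  | .amb _ P => P.pvars
  | .act _ P => P.pvars
  | .res _ P => P.pvars
  | .par P Q => P.pvars ∪ Q.pvars
  | .pvar X => {X}
  | .vamb _ P => P.pvars

/-- The name variables of an extended process. -/
def XProc.nvars : XProc N → Finset ℕ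
  | .nil => ∅
  | .amb _ P => P.nvars
  | .act _ P => P.nvars
  | .res _ P => P.nvars
  | .par P Q => P.nvars ∪ Q.nvars
  | .pvar _ => ∅
  | .vamb x P => insert x P.nvars

variable [DecidableEq N]

/-- `R` is a barbed saturated bisimulation. -/
def IsBarbedSatBisim (R : Proc N → Proc N → Prop) : Prop :=
  (∀ P Q, R P Q → R Q P) ∧
  ∀ P Q, R P Q → ∀ C : Ctx N,
    (∀ o, Barb (C.fill P) o → Barb (C.fill Q) o) ∧
    (∀ P', Red (C.fill P) P' → ∃ Q', Red (C.fill Q) Q' ∧ R P' Q')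

/-- Barbed saturated bisimilarity: the union of all barbed saturated bisimulations. -/
def BarbedSat (P Q : Proc N) : Prop :=
  ∃ R : Proc N → Proc N → Prop, IsBarbedSatBisim R ∧ R P Q

/-- The LTS `M`: labels are extended contexts and targets are extended processes. The process
variables `X₁, X₂` are `pvar 1, pvar 2` and the name variable `x` has index `0`. -/
inductive TransM : Proc N → XCtx N → XProc N → Prop
  | tau {P Q} : Red P Q → TransM P .hole Q.toX
  | goIn {P} (A m P₁ P₂) : m ∉ A →
      StrCong P (.resAll A (.par (.act (.goIn m) P₁) P₂)) →
      TransM P (.parL (.vamb 0 (.parL .hole (.pvar 1))) (.amb m (.pvar 2)))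
        (.resAll A (.amb m (.par (.vamb 0 (.par (.par P₁.toX P₂.toX) (.pvar 1))) (.pvar 2))))
  | inAmb {P} (A n m P₁ P₂ P₃) : m ∉ A →
      StrCong P (.resAll A (.par (.amb n (.par (.act (.goIn m) P₁) P₂)) P₃)) →
      TransM P (.parL .hole (.amb m (.pvar 1)))
        (.resAll A (.par (.amb m (.par (.amb n (.par P₁.toX P₂.toX)) (.pvar 1))) P₃.toX))
  | coIn {P} (A m P₁ P₂) : m ∉ A →
      StrCong P (.resAll A (.par (.amb m P₁) P₂)) →
      TransM P (.parL .hole (.vamb 0 (.par (.act (.goIn m) (.pvar 1)) (.pvar 2))))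
        (.resAll A (.par (.amb m (.par (.vamb 0 (.par (.pvar 1) (.pvar 2))) P₁.toX)) P₂.toX))
  | goOut {P} (A m P₁ P₂) : m ∉ A →
      StrCong P (.resAll A (.par (.act (.goOut m) P₁) P₂)) →
      TransM P (.amb m (.parL (.vamb 0 (.parL .hole (.pvar 1))) (.pvar 2)))
        (.resAll A (.par (.amb m (.pvar 2)) (.vamb 0 (.par (.par P₁.toX P₂.toX) (.pvar 1)))))
  | outAmb {P} (A n m P₁ P₂ P₃) : m ∉ A →
      StrCong P (.resAll A (.par (.amb n (.par (.act (.goOut m) P₁) P₂)) P₃)) →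
      TransM P (.amb m (.parL .hole (.pvar 1)))
        (.resAll A (.par (.amb m (.par P₃.toX (.pvar 1))) (.amb n (.par P₁.toX P₂.toX))))
  | opn {P} (A n P₁ P₂) : n ∉ A →
      StrCong P (.resAll A (.par (.act (.opn n) P₁) P₂)) →
      TransM P (.parL .hole (.amb n (.pvar 1)))
        (.resAll A (.par (.par P₁.toX P₂.toX) (.pvar 1)))
  | coOpen {P} (A n P₁ P₂) : n ∉ A →
      StrCong P (.resAll A (.par (.amb n P₁) P₂)) →
      TransM P (.parL .hole (.act (.opn n) (.pvar 1)))
        (.resAll A (.par (.par P₁.toX (.pvar 1)) P₂.toX))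

variable [Infinite N]

/-- A name outside the finite set `s`. -/
noncomputable def fresh (s : Finset N) : N := (Infinite.exists_notMem_finset s).choose

/-- Simultaneous capture-avoiding instantiation: free names are renamed by `ρ` and variables are
replaced according to `σ`. Each binder is replaced by a name that differs from all names that the
instantiation brings into its scope. -/
noncomputable def XProc.inst (σ : Subst N) : (N → N) → XProc N → Proc N
  | _, .nil => .nil
  | ρ, .amb n P => .amb (ρ n) (P.inst σ ρ)
  | ρ, .act M P => .act (M.map ρ) (P.inst σ ρ)
  | ρ, .res n P =>
      let p := fresh ((P.fn.erase n).image ρ ∪ P.pvars.biUnion (fun X => (σ.proc X).fn) ∪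
        P.nvars.image σ.name)
      .res p (P.inst σ (Function.update ρ n p))
  | ρ, .par P Q => .par (P.inst σ ρ) (Q.inst σ ρ)
  | _, .pvar X => σ.proc X
  | ρ, .vamb x P => .amb (σ.name x) (P.inst σ ρ)

/-- The extended process `P` under the substitution `σ`. -/
noncomputable def XProc.subst (σ : Subst N) (P : XProc N) : Proc N := P.inst σ id

/-- The extended context `C` under the substitution `σ`. -/
noncomputable def XCtx.subst (σ : Subst N) : XCtx N → Ctx N
  | .hole => .hole
  | .amb n C => .amb n (C.subst σ)
  | .vamb x C => .amb (σ.name x) (C.subst σ)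
  | .act M C => .act M (C.subst σ)
  | .parL C R => .parL (C.subst σ) (R.subst σ)
  | .parR R C => .parR (R.subst σ) (C.subst σ)

/-- The LTS `M_I`: all instances of the transitions of `M`. -/
def TransMI (P : Proc N) (C : Ctx N) (Q : Proc N) : Prop :=
  ∃ (D : XCtx N) (E : XProc N) (σ : Subst N),
    TransM P D E ∧ StrCong (E.subst σ) Q ∧ D.subst σ = C

end

/-- A binary predicate on processes is stable under a relation `R`. -/
def StableUnder {N : Type*} (R Pr : Proc N → Proc N → Prop) : Prop :=
  ∀ P Q P', R P Q → Pr P P' → ∃ Q', Pr Q Q' ∧ R P' Q'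

/-- The label `- | open n.T`. -/
def openLabel {N : Type*} (n : N) (T : Proc N) : Ctx N := .parL .hole (.act (.opn n) T)

/-- The predicate associated with the label `- | open n.T`; the testing context is
`- | open n.(m[0] | open m.T)`. -/
def OpenPred {N : Type*} [DecidableEq N] (n : N) (T X Y : Proc N) : Prop :=
  ∃ (P'' : Proc N) (m : N), m ∉ X.fn ∧
    Red ((openLabel n (.par (.amb m .nil) (.act (.opn m) T))).fill X) P'' ∧
    Barb P'' m ∧ Red P'' Y ∧ ¬ Barb Y m

end MA

namespace MA

/-! ### Free names, scope extrusion and renaming of binders. -/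

section StructuralCongruence

variable {N : Type*}

/-! Both the test and the transition amount to one decomposition: `X ≡ (νA)(n[P₁] | P₂)` with `n ∉
A`, and `Y ≡ (νA)(P₁ | P₂) | T`. For the transition this is `transMI_openLabel_iff`. Given the
decomposition, the test succeeds by opening `n` and then `m` (`open_test_of_split`). Conversely
(`OpenPred.split`), `m` is not free in `X`, so the barb `m` after the first step shows that the
prefix `open n` has fired; its loss in the second step shows that `m[0]` has been opened. Hence `X`
supplied an ambient `n` and did nothing else.

The difficulty is that reduction is closed under structural congruence. Restrictions are therefore
removed: `body` assigns names to all binders at once and erases them. A congruence or a reduction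
induces a bijection of binders, and for every assignment of names the bodies are then related by
`AC` or `Step` (`StrCong.ac_body`, `Red.step_body`). Without restrictions, `AC` is equality of
multisets of components (`AC.of_atoms_eq`), where redexes can be located and components cancelled;
this gives `Step.open_test`. The result returns to processes through `StrCong.prenex`.

For stability, the name `m` that witnesses the test of `P` may be free in `Q`. The decomposition
does not mention `m`, so the test of `P` is rerun with a name fresh for `Q`; bisimilarity then
transfers both steps and, by symmetry, the absence of the barb. -/

theorem Proc.map_id (P : Proc N) : P.map id = P := by
  induction P with
  | act M P ih => cases M <;> simp [Proc.map, Cap.map, ih]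
  | _ => simp_all [Proc.map]

theorem Proc.map_map (f g : N → N) (P : Proc N) : (P.map f).map g = P.map (g ∘ f) := by
  induction P with
  | act M P ih => cases M <;> simp [Proc.map, Cap.map, ih]
  | _ => simp_all [Proc.map]

theorem Cap.name_map (f : N → N) (M : Cap N) : (M.map f).name = f M.name := by
  cases M <;> rfl

theorem Cap.map_congr {ρ ρ' : N → N} {M : Cap N} (h : ρ M.name = ρ' M.name) :
    M.map ρ = M.map ρ' := by
  cases M <;> exact congrArg _ h

theorem Cap.map_map (f g : N → N) (M : Cap N) : (M.map f).map g = M.map (g ∘ f) := by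
  cases M <;> rfl

theorem Proc.map_resAll (f : N → N) (A : List N) (P : Proc N) :
    (Proc.resAll A P).map f = Proc.resAll (A.map f) (P.map f) := by
  induction A with
  | nil => rfl
  | cons a A ih => simpa [Proc.resAll, Proc.map] using ih

theorem Proc.resAll_append (A B : List N) (P : Proc N) :
    Proc.resAll (A ++ B) P = Proc.resAll A (Proc.resAll B P) := by
  simp [Proc.resAll]

variable [DecidableEq N]

theorem Proc.fn_map {f : N → N} (hf : f.Injective) (P : Proc N) :
    (P.map f).fn = P.fn.image f := by
  induction P with
  | nil => rfl
  | amb n P ih => simp [Proc.map, Proc.fn, ih]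
  | act M P ih => simp [Proc.map, Proc.fn, ih, Cap.name_map]
  | res n P ih => simp [Proc.map, Proc.fn, ih, Finset.image_erase hf]
  | par P Q ihP ihQ => simp [Proc.map, Proc.fn, ihP, ihQ, Finset.image_union]

theorem StrCong.fn_eq {P Q : Proc N} (h : StrCong P Q) : P.fn = Q.fn := by
  induction h with
  | refl P => rfl
  | symm _ ih => exact ih.symm
  | trans _ _ ih₁ ih₂ => exact ih₁.trans ih₂
  | par R _ ih => simp [Proc.fn, ih]
  | res n _ ih => simp [Proc.fn, ih]
  | amb n _ ih => simp [Proc.fn, ih]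
  | act M _ ih => simp [Proc.fn, ih]
  | par_comm P Q => simp [Proc.fn, Finset.union_comm]
  | par_assoc P Q R => simp [Proc.fn, Finset.union_assoc]
  | par_nil P => simp [Proc.fn]
  | res_comm n m P => simp [Proc.fn, Finset.erase_right_comm]
  | res_par n P Q h => simp [Proc.fn, Finset.erase_union_distrib, Finset.erase_eq_of_notMem h]
  | res_amb n m P h => simp [Proc.fn, Finset.erase_insert_of_ne h.symm]
  | res_act n M P h => simp [Proc.fn, Finset.erase_insert_of_ne h.symm]
  | alpha n m P h =>
    ext x
    simp only [Proc.fn, Proc.fn_map (Equiv.swap n m).injective, Finset.mem_erase,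
      Finset.mem_image]
    constructor
    · rintro ⟨hx, hxP⟩
      have hxm : x ≠ m := fun e => h (e ▸ hxP)
      exact ⟨hxm, x, hxP, Equiv.swap_apply_of_ne_of_ne hx hxm⟩
    · rintro ⟨hx, y, hy, rfl⟩
      have hym : y ≠ m := fun e => h (e ▸ hy)
      by_cases hyn : y = n
      · subst hyn
        simp at hx
      · rw [Equiv.swap_apply_of_ne_of_ne hyn hym]
        exact ⟨hyn, hy⟩

theorem StrCong.par_left {P Q : Proc N} (R : Proc N) (h : StrCong P Q) :
    StrCong (.par R P) (.par R Q) :=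
  ((StrCong.par_comm R P).trans (h.par R)).trans (StrCong.par_comm Q R)

theorem StrCong.par_congr {P P' Q Q' : Proc N} (h : StrCong P P') (h' : StrCong Q Q') :
    StrCong (.par P Q) (.par P' Q') :=
  (h.par Q).trans (h'.par_left P')

theorem StrCong.resAll {P Q : Proc N} (A : List N) (h : StrCong P Q) :
    StrCong (.resAll A P) (.resAll A Q) := by
  induction A with
  | nil => exact h
  | cons a A ih => exact ih.res a

theorem Proc.mem_fn_resAll {A : List N} {P : Proc N} {x : N} :
    x ∈ (Proc.resAll A P).fn ↔ x ∉ A ∧ x ∈ P.fn := by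
  induction A with
  | nil => simp [Proc.resAll]
  | cons a A ih =>
    change x ∈ (Proc.resAll A P).fn.erase a ↔ _
    simp only [Finset.mem_erase, ih, List.mem_cons, not_or, and_assoc]

theorem StrCong.resAll_par {A : List N} {P Q : Proc N} (h : ∀ a ∈ A, a ∉ Q.fn) :
    StrCong (.par (.resAll A P) Q) (.resAll A (.par P Q)) := by
  induction A with
  | nil => exact .refl _
  | cons a A ih =>
    have h₁ := ih fun b hb => h b (List.mem_cons_of_mem a hb)
    exact ((StrCong.par_comm _ _).trans (StrCong.res_par a _ _ (h a (by simp))).symm).trans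
      (((StrCong.par_comm _ _).trans h₁).res a)

theorem StrCong.resAll_amb {A : List N} {n : N} {P : Proc N} (h : n ∉ A) :
    StrCong (.amb n (.resAll A P)) (.resAll A (.amb n P)) := by
  induction A with
  | nil => exact .refl _
  | cons a A ih =>
    rw [List.mem_cons, not_or] at h
    exact (StrCong.res_amb a n _ (Ne.symm h.1)).symm.trans ((ih h.2).res a)

theorem StrCong.resAll_act {A : List N} {M : Cap N} {P : Proc N} (h : M.name ∉ A) :
    StrCong (.act M (.resAll A P)) (.resAll A (.act M P)) := by
  induction A with
  | nil => exact .refl _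
  | cons a A ih =>
    rw [List.mem_cons, not_or] at h
    exact (StrCong.res_act a M _ (Ne.symm h.1)).symm.trans ((ih h.2).res a)

theorem StrCong.resAll_perm {A B : List N} (h : A.Perm B) (P : Proc N) :
    StrCong (.resAll A P) (.resAll B P) := by
  induction h with
  | nil => exact .refl _
  | cons a _ ih => exact ih.res a
  | swap a b l => exact .res_comm _ _ _
  | trans _ _ ih₁ ih₂ => exact ih₁.trans ih₂

/-- The conditions are asymmetric because `A` is extruded first, past the still restricted `Q`, and
`B` afterwards, past the bare `P`. -/
theorem StrCong.par_resAll_resAll {A B : List N} {P Q : Proc N}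
    (hA : ∀ a ∈ A, a ∉ (Proc.resAll B Q).fn) (hB : ∀ b ∈ B, b ∉ P.fn) :
    StrCong (.par (.resAll A P) (.resAll B Q)) (.resAll (A ++ B) (.par P Q)) := by
  rw [Proc.resAll_append]
  exact (StrCong.resAll_par hA).trans (StrCong.resAll A
    ((StrCong.par_comm _ _).trans ((StrCong.resAll_par hB).trans
      (StrCong.resAll B (StrCong.par_comm _ _)))))

/-- Renaming of a bound name to any name that is not free in the restricted process. -/
theorem StrCong.rename {a p : N} {P : Proc N} (h : p ∉ (Proc.res a P).fn) :
    StrCong (.res a P) (.res p (P.map (Equiv.swap a p))) := by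
  by_cases hp : p = a
  · subst hp
    rw [Equiv.swap_self, Equiv.coe_refl, Proc.map_id]
    exact .refl _
  · exact .alpha a p P fun hP => h (Finset.mem_erase.2 ⟨hp, hP⟩)

theorem StrCong.rename_map {π : Equiv.Perm N} {n p : N} {P : Proc N}
    (h : ∀ x ∈ P.fn, x ≠ n → π x ≠ p) :
    StrCong (.res (π n) (P.map π)) (.res p (P.map (π.trans (Equiv.swap (π n) p)))) := by
  have := StrCong.rename (a := π n) (p := p) (P := P.map π) (by
    simp only [Proc.fn, Proc.fn_map π.injective, Finset.mem_erase, Finset.mem_image, not_and,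
      not_exists]
    intro hp x hx hxp
    refine h x hx ?_ hxp
    rintro rfl
    exact hp hxp.symm)
  rwa [Proc.map_map] at this

/-- Reconciles two ways of entering a binder: `alpha` renames by permutations, while `body` and
`XProc.inst` update a function that need not be injective. Agreement on the free names is all that
matters. -/
theorem swap_trans_eq_update {π : Equiv.Perm N} {ρ : N → N} {n p : N} {P : Proc N}
    (hρ : ∀ x ∈ (Proc.res n P).fn, π x = ρ x) (h : ∀ x ∈ P.fn, x ≠ n → π x ≠ p) :
    ∀ x ∈ P.fn, (π.trans (Equiv.swap (π n) p)) x = Function.update ρ n p x := by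
  intro x hx
  by_cases hxn : x = n
  · subst hxn
    simp
  · rw [Function.update_of_ne hxn, ← hρ x (Finset.mem_erase.2 ⟨hxn, hx⟩), Equiv.trans_apply,
      Equiv.swap_apply_of_ne_of_ne (fun e => hxn (π.injective e)) (h x hx hxn)]

end StructuralCongruence

/-! ### Prenex forms with a free choice of bound names. -/

section Prenex

variable {N : Type*}

/-- The occurrences of restrictions in a process. -/
def Binder : Proc N → Type
  | .nil => Empty
  | .amb _ P => Binder P
  | .act _ P => Binder P
  | .res _ P => Option (Binder P)
  | .par P Q => Binder P ⊕ Binder Q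

theorem Binder.finite (P : Proc N) : Finite (Binder P) := by
  induction P with
  | nil => exact inferInstanceAs (Finite Empty)
  | amb n P ih => exact ih
  | act M P ih => exact ih
  | res n P ih => exact inferInstanceAs (Finite (Option (Binder P)))
  | par P Q ihP ihQ => exact inferInstanceAs (Finite (Binder P ⊕ Binder Q))

/-- The names given by `f` to the restrictions of a process. -/
def binderNames : (P : Proc N) → (Binder P → N) → List N
  | .nil, _ => []
  | .amb _ P, f => binderNames P f
  | .act _ P, f => binderNames P f
  | .res _ P, f => f none :: binderNames P fun i => f (some i)
  | .par P Q, f => binderNames P (fun i => f (.inl i)) ++ binderNames Q (fun i => f (.inr i))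

theorem mem_binderNames {P : Proc N} {f : Binder P → N} {x : N} :
    x ∈ binderNames P f ↔ ∃ i, f i = x := by
  induction P with
  | nil => exact ⟨fun h => absurd h List.not_mem_nil, fun ⟨i, _⟩ => i.elim⟩
  | amb n P ih => exact ih
  | act M P ih => exact ih
  | res n P ih =>
    refine List.mem_cons.trans ((or_congr eq_comm ih).trans ?_)
    exact (Option.exists (p := fun i => f i = x)).symm
  | par P Q ihP ihQ =>
    refine List.mem_append.trans ((or_congr ihP ihQ).trans ?_)
    exact (Sum.exists (p := fun i => f i = x)).symm

theorem nodup_binderNames {P : Proc N} {f : Binder P → N} (hf : f.Injective) :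
    (binderNames P f).Nodup := by
  induction P with
  | nil => exact List.nodup_nil
  | amb n P ih => exact ih hf
  | act M P ih => exact ih hf
  | res n P ih =>
    refine List.nodup_cons.2 ⟨fun h => ?_, ih (hf.comp (Option.some_injective _))⟩
    obtain ⟨i, hi⟩ := mem_binderNames.1 h
    cases hf hi
  | par P Q ihP ihQ =>
    refine List.Nodup.append (ihP (hf.comp Sum.inl_injective)) (ihQ (hf.comp Sum.inr_injective)) ?_
    intro x hx hx'
    obtain ⟨i, hi⟩ := mem_binderNames.1 hx
    obtain ⟨j, hj⟩ := mem_binderNames.1 hx'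
    cases hf (hi.trans hj.symm)

/-- Injectivity makes both lists duplicate-free, so having the same members suffices. -/
theorem binderNames_perm {P Q : Proc N} (e : Binder P ≃ Binder Q) {f : Binder Q → N}
    (hf : f.Injective) : (binderNames P (f ∘ e)).Perm (binderNames Q f) := by
  refine (List.perm_ext_iff_of_nodup (nodup_binderNames (hf.comp e.injective))
    (nodup_binderNames hf)).2 fun x => ?_
  rw [mem_binderNames, mem_binderNames]
  exact e.exists_congr_left.trans (by simp)

/-- The restrictions of `P.map f` correspond to those of `P`. -/
def binderMap (f : N → N) : (P : Proc N) → Binder P ≃ Binder (P.map f)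
  | .nil => Equiv.refl _
  | .amb _ P => binderMap f P
  | .act _ P => binderMap f P
  | .res _ P => Equiv.optionCongr (binderMap f P)
  | .par P Q => Equiv.sumCongr (binderMap f P) (binderMap f Q)

variable [DecidableEq N]

/-- The process without its restrictions, their names being given by `f` and the free names being
renamed by `ρ`. -/
def body : (P : Proc N) → (Binder P → N) → (N → N) → Proc N
  | .nil, _, _ => .nil
  | .amb n P, f, ρ => .amb (ρ n) (body P f ρ)
  | .act M P, f, ρ => .act (M.map ρ) (body P f ρ)
  | .res n P, f, ρ => body P (fun i => f (some i)) (Function.update ρ n (f none))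
  | .par P Q, f, ρ => .par (body P (fun i => f (.inl i)) ρ) (body Q (fun i => f (.inr i)) ρ)

theorem body_congr {P : Proc N} (f : Binder P → N) {ρ ρ' : N → N} (h : ∀ x ∈ P.fn, ρ x = ρ' x) :
    body P f ρ = body P f ρ' := by
  induction P generalizing ρ ρ' with
  | nil => rfl
  | amb n P ih =>
    simp only [body]
    rw [ih f fun x hx => h x (Finset.mem_insert_of_mem hx), h n (Finset.mem_insert_self _ _)]
  | act M P ih =>
    simp only [body]
    rw [ih f fun x hx => h x (Finset.mem_insert_of_mem hx),
      Cap.map_congr (h _ (Finset.mem_insert_self _ _))]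
  | res n P ih =>
    refine ih _ fun x hx => ?_
    by_cases hxn : x = n
    · simp [hxn]
    · simp [hxn, h x (Finset.mem_erase.2 ⟨hxn, hx⟩)]
  | par P Q ihP ihQ =>
    simp only [body]
    rw [ihP _ fun x hx => h x (Finset.mem_union_left _ hx),
      ihQ _ fun x hx => h x (Finset.mem_union_right _ hx)]

theorem body_map {g : N → N} (hg : g.Injective) (P : Proc N) (f : Binder (P.map g) → N)
    (ρ : N → N) : body (P.map g) f ρ = body P (f ∘ binderMap g P) (ρ ∘ g) := by
  induction P generalizing ρ with
  | nil => rfl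
  | amb n P ih => exact congrArg _ (ih f ρ)
  | act M P ih => exact congrArg₂ _ (Cap.map_map g ρ M) (ih f ρ)
  | res n P ih =>
    refine (ih _ _).trans ?_
    rw [Function.update_comp_eq_of_injective ρ hg]
    rfl
  | par P Q ihP ihQ => exact congrArg₂ _ (ihP _ ρ) (ihQ _ ρ)

theorem mem_fn_body {P : Proc N} {f : Binder P → N} {ρ : N → N} {x : N}
    (hx : x ∈ (body P f ρ).fn) : (∃ y ∈ P.fn, ρ y = x) ∨ ∃ i, f i = x := by
  induction P generalizing ρ with
  | nil => simp [body, Proc.fn] at hx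
  | amb n P ih =>
    rcases Finset.mem_insert.1 hx with rfl | hx
    · exact .inl ⟨n, Finset.mem_insert_self _ _, rfl⟩
    · exact (ih hx).imp_left fun ⟨y, hy, e⟩ => ⟨y, Finset.mem_insert_of_mem hy, e⟩
  | act M P ih =>
    rcases Finset.mem_insert.1 hx with rfl | hx
    · exact .inl ⟨_, Finset.mem_insert_self _ _, (Cap.name_map ρ M).symm⟩
    · exact (ih hx).imp_left fun ⟨y, hy, e⟩ => ⟨y, Finset.mem_insert_of_mem hy, e⟩
  | res n P ih =>
    rcases ih hx with ⟨y, hy, e⟩ | ⟨i, hi⟩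
    · by_cases hyn : y = n
      · subst hyn
        exact .inr ⟨none, by simpa using e⟩
      · exact .inl ⟨y, Finset.mem_erase.2 ⟨hyn, hy⟩, by simpa [hyn] using e⟩
    · exact .inr ⟨some i, hi⟩
  | par P Q ihP ihQ =>
    rcases Finset.mem_union.1 hx with hx | hx
    · exact (ihP hx).imp (fun ⟨y, hy, e⟩ => ⟨y, Finset.mem_union_left _ hy, e⟩)
        fun ⟨i, hi⟩ => ⟨.inl i, hi⟩
    · exact (ihQ hx).imp (fun ⟨y, hy, e⟩ => ⟨y, Finset.mem_union_right _ hy, e⟩)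
        fun ⟨i, hi⟩ => ⟨.inr i, hi⟩

/-- Every process is congruent to its prenex form. -/
theorem StrCong.prenex_map {P : Proc N} {f : Binder P → N} (hf : f.Injective) (π : Equiv.Perm N)
    (h : ∀ i, ∀ x ∈ P.fn, π x ≠ f i) :
    StrCong (P.map π) (.resAll (binderNames P f) (body P f π)) := by
  induction P generalizing π with
  | nil => exact .refl _
  | amb n P ih =>
    refine ((ih hf π fun i x hx => h i x (Finset.mem_insert_of_mem hx)).amb (π n)).trans
      (StrCong.resAll_amb fun hn => ?_)
    obtain ⟨i, hi⟩ := mem_binderNames.1 hn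
    exact h i n (Finset.mem_insert_self _ _) hi.symm
  | act M P ih =>
    refine ((ih hf π fun i x hx => h i x (Finset.mem_insert_of_mem hx)).act (M.map π)).trans
      (StrCong.resAll_act fun hn => ?_)
    obtain ⟨i, hi⟩ := mem_binderNames.1 hn
    exact h i M.name (Finset.mem_insert_self _ _) ((hi.trans (Cap.name_map _ M)).symm)
  | res n P ih =>
    have h₀ : ∀ x ∈ P.fn, x ≠ n → π x ≠ f none :=
      fun x hx hxn => h none x (Finset.mem_erase.2 ⟨hxn, hx⟩)
    have h₁ := swap_trans_eq_update (ρ := π) (fun _ _ => rfl) h₀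
    refine (StrCong.rename_map h₀).trans (StrCong.res _ ?_)
    -- Below the binder the permutation also sends `n` to `f none`; injectivity of `f` keeps this
    -- value apart from the names of the inner binders.
    have := ih (f := fun i => f (some i)) (hf.comp (Option.some_injective _))
      (π.trans (Equiv.swap (π n) (f none))) (by
        intro i x hx
        rw [h₁ x hx]
        by_cases hxn : x = n
        · subst hxn
          simp only [Function.update_self]
          intro e
          cases hf e
        · rw [Function.update_of_ne hxn]
          exact h _ x (Finset.mem_erase.2 ⟨hxn, hx⟩))
    rwa [body_congr _ h₁] at this
  | par P Q ihP ihQ =>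
    have hP := ihP (f := fun i => f (.inl i)) (hf.comp Sum.inl_injective) π
      fun i x hx => h _ x (Finset.mem_union_left _ hx)
    have hQ := ihQ (f := fun i => f (.inr i)) (hf.comp Sum.inr_injective) π
      fun i x hx => h _ x (Finset.mem_union_right _ hx)
    refine (hP.par_congr hQ).trans (StrCong.par_resAll_resAll ?_ ?_)
    · intro a ha
      obtain ⟨i, rfl⟩ := mem_binderNames.1 ha
      rw [← hQ.fn_eq, Proc.fn_map π.injective, Finset.mem_image]
      rintro ⟨x, hx, e⟩
      exact h _ x (Finset.mem_union_right _ hx) e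
    · intro a ha ha'
      obtain ⟨i, rfl⟩ := mem_binderNames.1 ha
      rcases mem_fn_body ha' with ⟨x, hx, e⟩ | ⟨j, hj⟩
      · exact h _ x (Finset.mem_union_left _ hx) e
      · cases hf hj

theorem StrCong.prenex {P : Proc N} {f : Binder P → N} (hf : f.Injective)
    (h : ∀ i, f i ∉ P.fn) : StrCong P (.resAll (binderNames P f) (body P f id)) := by
  have := StrCong.prenex_map hf (Equiv.refl N) fun i x hx e => h i (by
    rw [← e]
    exact hx)
  rwa [Equiv.coe_refl, Proc.map_id] at this

end Prenex
end MA
namespace MA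

/-! ### Congruence and reduction after erasing restrictions. -/

section Reduction

variable {N : Type*}

/-- The least congruence making parallel composition a commutative monoid. -/
inductive AC : Proc N → Proc N → Prop
  | refl (P) : AC P P
  | symm {P Q} : AC P Q → AC Q P
  | trans {P Q R} : AC P Q → AC Q R → AC P R
  | par {P Q} (R) : AC P Q → AC (.par P R) (.par Q R)
  | amb {P Q} (n) : AC P Q → AC (.amb n P) (.amb n Q)
  | act {P Q} (M) : AC P Q → AC (.act M P) (.act M Q)
  | par_comm (P Q) : AC (.par P Q) (.par Q P)
  | par_assoc (P Q R) : AC (.par (.par P Q) R) (.par P (.par Q R))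
  | par_nil (P) : AC (.par P .nil) P

/-- Reductions that involve no restriction. -/
inductive Step : Proc N → Proc N → Prop
  | goIn (n m P Q R) :
      Step (.par (.amb n (.par (.act (.goIn m) P) Q)) (.amb m R))
        (.amb m (.par (.amb n (.par P Q)) R))
  | goOut (n m P Q R) :
      Step (.amb m (.par (.amb n (.par (.act (.goOut m) P) Q)) R))
        (.par (.amb n (.par P Q)) (.amb m R))
  | opn (n P Q) : Step (.par (.act (.opn n) P) (.amb n Q)) (.par P Q)
  | amb {P Q} (n) : Step P Q → Step (.amb n P) (.amb n Q)
  | par {P Q} (R) : Step P Q → Step (.par P R) (.par Q R)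
  | congr {P P' Q' Q} : AC P P' → Step P' Q' → AC Q' Q → Step P Q

theorem AC.of_eq {P Q : Proc N} (h : P = Q) : AC P Q := h ▸ .refl P

theorem AC.par_congr {P P' Q Q' : Proc N} (h : AC P P') (h' : AC Q Q') :
    AC (.par P Q) (.par P' Q') :=
  (h.par Q).trans ((AC.par_comm _ _).trans ((h'.par P').trans (AC.par_comm _ _)))

/-- `Option` distributes over the right summand. -/
def optionSumEquiv (α β : Type) : Option (α ⊕ β) ≃ α ⊕ Option β where
  toFun
    | none => .inr none
    | some (.inl a) => .inl a
    | some (.inr b) => .inr (some b)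
  invFun
    | .inl a => some (.inl a)
    | .inr none => none
    | .inr (some b) => some (.inr b)
  left_inv := by rintro (_ | _ | _) <;> rfl
  right_inv := by rintro (_ | _ | _) <;> rfl

/-- Exchange of the two added elements. -/
def optionOptionEquiv (α : Type) : Option (Option α) ≃ Option (Option α) where
  toFun
    | none => some none
    | some none => none
    | some (some a) => some (some a)
  invFun
    | none => some none
    | some none => none
    | some (some a) => some (some a)
  left_inv := by rintro (_ | _ | _) <;> rfl
  right_inv := by rintro (_ | _ | _) <;> rfl

variable [DecidableEq N]

theorem AC.strCong {P Q : Proc N} (h : AC P Q) : StrCong P Q := by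
  induction h with
  | refl P => exact .refl P
  | symm _ ih => exact ih.symm
  | trans _ _ ih₁ ih₂ => exact ih₁.trans ih₂
  | par R _ ih => exact ih.par R
  | amb n _ ih => exact ih.amb n
  | act M _ ih => exact ih.act M
  | par_comm P Q => exact .par_comm P Q
  | par_assoc P Q R => exact .par_assoc P Q R
  | par_nil P => exact .par_nil P

/-- Each axiom only moves or renames binders, so tracking them gives a bijection. No freshness of
`f` is needed: once the binders carry assigned names, the axioms about restriction become equalities
up to `AC`. -/
theorem StrCong.ac_body {P Q : Proc N} (h : StrCong P Q) :
    ∃ σ : Binder P ≃ Binder Q, ∀ f ρ, AC (body P (f ∘ σ) ρ) (body Q f ρ) := by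
  induction h with
  | refl P => exact ⟨Equiv.refl _, fun f ρ => .refl _⟩
  | @symm P Q _ ih =>
    obtain ⟨σ, h⟩ := ih
    refine ⟨σ.symm, fun f ρ => ?_⟩
    have := h (f ∘ σ.symm) ρ
    rw [Function.comp_assoc, Equiv.symm_comp_self] at this
    exact this.symm
  | trans _ _ ih₁ ih₂ =>
    obtain ⟨σ, h⟩ := ih₁
    obtain ⟨τ, h'⟩ := ih₂
    exact ⟨σ.trans τ, fun f ρ => (h (f ∘ τ) ρ).trans (h' f ρ)⟩
  | par R _ ih =>
    obtain ⟨σ, h⟩ := ih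
    exact ⟨Equiv.sumCongr σ (Equiv.refl _), fun f ρ => (h (fun i => f (.inl i)) ρ).par _⟩
  | res n _ ih =>
    obtain ⟨σ, h⟩ := ih
    exact ⟨Equiv.optionCongr σ, fun f ρ => h (fun i => f (some i)) _⟩
  | amb n _ ih =>
    obtain ⟨σ, h⟩ := ih
    exact ⟨σ, fun f ρ => (h f ρ).amb _⟩
  | act M _ ih =>
    obtain ⟨σ, h⟩ := ih
    exact ⟨σ, fun f ρ => (h f ρ).act _⟩
  | par_comm P Q => exact ⟨Equiv.sumComm _ _, fun f ρ => .par_comm _ _⟩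
  | par_assoc P Q R => exact ⟨Equiv.sumAssoc _ _ _, fun f ρ => .par_assoc _ _ _⟩
  | par_nil P => exact ⟨Equiv.sumEmpty _ Empty, fun f ρ => .par_nil _⟩
  | res_comm n m P =>
    -- If the two names coincide, the inner restriction shadows the outer one, and the identity
    -- rather than the exchange is the right bijection.
    by_cases hnm : n = m
    · subst hnm
      exact ⟨Equiv.refl _, fun f ρ => .refl _⟩
    · refine ⟨optionOptionEquiv _, fun f ρ => .of_eq ?_⟩
      change MA.body P _ _ = MA.body P _ _
      rw [Function.update_comm hnm]
      rfl
  | res_par n P Q hn =>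
    refine ⟨optionSumEquiv _ _, fun f ρ => ?_⟩
    refine .par_congr (.of_eq (body_congr _ fun x hx => ?_)) (.refl _)
    refine Function.update_of_ne ?_ _ _
    rintro rfl
    exact hn hx
  | res_amb n m P hnm =>
    refine ⟨Equiv.refl _, fun f ρ => ?_⟩
    change AC (.amb (Function.update ρ n (f none) m) _) (.amb (ρ m) _)
    rw [Function.update_of_ne hnm.symm]
    exact .refl _
  | res_act n M P hnM =>
    refine ⟨Equiv.refl _, fun f ρ => ?_⟩
    change AC (.act (M.map (Function.update ρ n (f none))) _) (.act (M.map ρ) _)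
    rw [Cap.map_congr (Function.update_of_ne hnM.symm _ _)]
    exact .refl _
  | alpha n m P hm =>
    refine ⟨Equiv.optionCongr (binderMap _ P), fun f ρ => ?_⟩
    have : body (.res m (P.map (Equiv.swap n m))) f ρ
        = body P ((fun i => f (some i)) ∘ binderMap _ P) (Function.update ρ n (f none)) := by
      refine (body_map (Equiv.swap n m).injective P _ _).trans (body_congr _ fun x hx => ?_)
      by_cases hxn : x = n
      · simp [hxn]
      · have hxm : x ≠ m := fun e => hm (e ▸ hx)
        simp [hxn, hxm, Equiv.swap_apply_of_ne_of_ne hxn hxm]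
    rw [this]
    exact .refl _

/-- Reduction neither creates, destroys nor duplicates a restriction, so the binders of the target
can be traced back to those of the source. -/
theorem Red.step_body {P Q : Proc N} (h : Red P Q) :
    ∃ σ : Binder P ≃ Binder Q, ∀ f ρ, Step (body P (f ∘ σ) ρ) (body Q f ρ) := by
  induction h with
  | goIn n m P Q R => exact ⟨Equiv.refl _, fun f ρ => .goIn _ _ _ _ _⟩
  | goOut n m P Q R => exact ⟨Equiv.refl _, fun f ρ => .goOut _ _ _ _ _⟩
  | opn n P Q => exact ⟨Equiv.refl _, fun f ρ => .opn _ _ _⟩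
  | res n _ ih =>
    obtain ⟨σ, h⟩ := ih
    exact ⟨Equiv.optionCongr σ, fun f ρ => h (fun i => f (some i)) _⟩
  | amb n _ ih =>
    obtain ⟨σ, h⟩ := ih
    exact ⟨σ, fun f ρ => (h f ρ).amb _⟩
  | par R _ ih =>
    obtain ⟨σ, h⟩ := ih
    exact ⟨Equiv.sumCongr σ (Equiv.refl _), fun f ρ => (h (fun i => f (.inl i)) ρ).par _⟩
  | congr h₁ _ h₂ ih =>
    obtain ⟨σ₁, h₁⟩ := h₁.ac_body
    obtain ⟨σ, h⟩ := ih
    obtain ⟨σ₂, h₂⟩ := h₂.ac_body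
    exact ⟨σ₁.trans (σ.trans σ₂), fun f ρ => .congr (h₁ (f ∘ σ₂ ∘ σ) ρ) (h (f ∘ σ₂) ρ) (h₂ f ρ)⟩

end Reduction

/-! ### Parallel components and analysis of redexes. -/

section Atoms

variable {N : Type*}

/-- Processes up to `AC`. -/
def acSetoid (N : Type*) : Setoid (Proc N) := ⟨AC, AC.refl, AC.symm, AC.trans⟩

/-- Components of a process that are not parallel compositions. -/
inductive Atom (N : Type*) where
  | amb (n : N) (q : Quotient (acSetoid N))
  | act (M : Cap N) (q : Quotient (acSetoid N))
  | res (n : N) (P : Proc N)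

/-- The multiset of the parallel components. -/
def Proc.atoms : Proc N → Multiset (Atom N)
  | .nil => 0
  | .amb n P => {.amb n (Quotient.mk _ P)}
  | .act M P => {.act M (Quotient.mk _ P)}
  | .res n P => {.res n P}
  | .par P Q => P.atoms + Q.atoms

/-- A process with a given single component. -/
noncomputable def Atom.out : Atom N → Proc N
  | .amb n q => .amb n q.out
  | .act M q => .act M q.out
  | .res n P => .res n P

theorem AC.quotient_eq {P Q : Proc N} (h : AC P Q) :
    (Quotient.mk (acSetoid N) P) = Quotient.mk (acSetoid N) Q := Quotient.sound h

theorem AC.of_quotient_eq {P Q : Proc N}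
    (h : (Quotient.mk (acSetoid N) P) = Quotient.mk (acSetoid N) Q) : AC P Q := Quotient.exact h

theorem AC.atoms_eq {P Q : Proc N} (h : AC P Q) : P.atoms = Q.atoms := by
  induction h with
  | refl P => rfl
  | symm _ ih => exact ih.symm
  | trans _ _ ih₁ ih₂ => exact ih₁.trans ih₂
  | par R _ ih => simp [Proc.atoms, ih]
  | amb n h _ => simp [Proc.atoms, h.quotient_eq]
  | act M h _ => simp [Proc.atoms, h.quotient_eq]
  | par_comm P Q => exact add_comm _ _
  | par_assoc P Q R => exact add_assoc _ _ _
  | par_nil P => exact add_zero _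

theorem AC.exists_par_of_mem {P : Proc N} {a : Atom N} (h : a ∈ P.atoms) :
    ∃ R, AC P (.par a.out R) := by
  induction P with
  | nil => simp [Proc.atoms] at h
  | amb n P ih =>
    rw [Proc.atoms, Multiset.mem_singleton] at h
    subst h
    exact ⟨.nil, ((AC.of_quotient_eq (Quotient.out_eq _)).symm.amb n).trans (AC.par_nil _).symm⟩
  | act M P ih =>
    rw [Proc.atoms, Multiset.mem_singleton] at h
    subst h
    exact ⟨.nil, ((AC.of_quotient_eq (Quotient.out_eq _)).symm.act M).trans (AC.par_nil _).symm⟩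
  | res n P ih =>
    rw [Proc.atoms, Multiset.mem_singleton] at h
    subst h
    exact ⟨.nil, (AC.par_nil _).symm⟩
  | par P Q ihP ihQ =>
    rcases Multiset.mem_add.1 h with h | h
    · obtain ⟨R, hR⟩ := ihP h
      exact ⟨.par R Q, (hR.par Q).trans (AC.par_assoc _ _ _)⟩
    · obtain ⟨R, hR⟩ := ihQ h
      exact ⟨.par R P, (AC.par_comm _ _).trans ((hR.par P).trans (AC.par_assoc _ _ _))⟩

theorem Atom.atoms_out (a : Atom N) : a.out.atoms = {a} := by
  cases a <;> simp [Atom.out, Proc.atoms]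

theorem AC.nil_of_atoms_eq_zero {P : Proc N} (h : P.atoms = 0) : AC P .nil := by
  induction P with
  | nil => exact .refl _
  | par P Q ihP ihQ =>
    obtain ⟨hP, hQ⟩ := add_eq_zero.1 h
    exact (AC.par_congr (ihP hP) (ihQ hQ)).trans (AC.par_nil _)
  | _ => simp [Proc.atoms] at h

/-- Contents of ambients and prefixes are recorded up to `AC`, so the multiset loses nothing: a
common component can be split off both sides. Together with `AC.atoms_eq` this makes parallel
composition cancellative. -/
theorem AC.of_atoms_eq {P Q : Proc N} (h : P.atoms = Q.atoms) : AC P Q := by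
  generalize hs : P.atoms = s at h
  induction s using Multiset.induction generalizing P Q with
  | empty => exact (nil_of_atoms_eq_zero hs).trans (nil_of_atoms_eq_zero h.symm).symm
  | cons a s ih =>
    obtain ⟨R, hR⟩ := AC.exists_par_of_mem (P := P) (a := a) (by simp [hs])
    obtain ⟨R', hR'⟩ := AC.exists_par_of_mem (P := Q) (a := a) (by simp [← h])
    have h₁ := hR.atoms_eq
    have h₂ := hR'.atoms_eq
    rw [hs, Proc.atoms, Atom.atoms_out, Multiset.singleton_add, Multiset.cons_inj_right] at h₁
    rw [← h, Proc.atoms, Atom.atoms_out, Multiset.singleton_add, Multiset.cons_inj_right] at h₂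
    exact hR.trans ((AC.par_congr (.refl _) (ih h₁.symm h₂)).trans hR'.symm)

/-- The process has an ambient `m` at top level. -/
def Exposes (P : Proc N) (m : N) : Prop := ∃ q, Atom.amb m q ∈ P.atoms

theorem Exposes.congr {P Q : Proc N} {m : N} (h : AC P Q) (hP : Exposes P m) : Exposes Q m := by
  rwa [Exposes, ← h.atoms_eq]

theorem Exposes.exists_ac {P : Proc N} {m : N} (h : Exposes P m) :
    ∃ Q R, AC P (.par (.amb m Q) R) := by
  obtain ⟨q, hq⟩ := h
  obtain ⟨R, hR⟩ := AC.exists_par_of_mem hq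
  exact ⟨_, R, hR⟩

/-- The redex of a reduction without restrictions, relative to the top level. -/
theorem Step.redex {P Q : Proc N} (h : Step P Q) :
    (∃ a P₁ P₂ R, Step P₁ P₂ ∧ AC P (.par (.amb a P₁) R) ∧ AC Q (.par (.amb a P₂) R)) ∨
    (∃ a b P₁ P₂ P₃ R,
      AC P (.par (.par (.amb a (.par (.act (.goIn b) P₁) P₂)) (.amb b P₃)) R) ∧
      AC Q (.par (.amb b (.par (.amb a (.par P₁ P₂)) P₃)) R)) ∨
    (∃ a b P₁ P₂ P₃ R,
      AC P (.par (.amb b (.par (.amb a (.par (.act (.goOut b) P₁) P₂)) P₃)) R) ∧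
      AC Q (.par (.par (.amb a (.par P₁ P₂)) (.amb b P₃)) R)) ∨
    (∃ a P₁ P₂ R,
      AC P (.par (.par (.act (.opn a) P₁) (.amb a P₂)) R) ∧ AC Q (.par (.par P₁ P₂) R)) := by
  induction h with
  | goIn n m P Q R =>
    exact .inr (.inl ⟨n, m, P, Q, R, .nil, (AC.par_nil _).symm, (AC.par_nil _).symm⟩)
  | goOut n m P Q R =>
    exact .inr (.inr (.inl ⟨n, m, P, Q, R, .nil, (AC.par_nil _).symm, (AC.par_nil _).symm⟩))
  | opn n P Q =>
    exact .inr (.inr (.inr ⟨n, P, Q, .nil, (AC.par_nil _).symm, (AC.par_nil _).symm⟩))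
  | amb n h _ => exact .inl ⟨n, _, _, .nil, h, (AC.par_nil _).symm, (AC.par_nil _).symm⟩
  | par S _ ih =>
    rcases ih with ⟨a, P₁, P₂, R, h, h₁, h₂⟩ | ⟨a, b, P₁, P₂, P₃, R, h₁, h₂⟩ |
      ⟨a, b, P₁, P₂, P₃, R, h₁, h₂⟩ | ⟨a, P₁, P₂, R, h₁, h₂⟩
    · exact .inl ⟨a, P₁, P₂, .par R S, h, (h₁.par S).trans (AC.par_assoc _ _ _),
        (h₂.par S).trans (AC.par_assoc _ _ _)⟩
    · exact .inr (.inl ⟨a, b, P₁, P₂, P₃, .par R S, (h₁.par S).trans (AC.par_assoc _ _ _),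
        (h₂.par S).trans (AC.par_assoc _ _ _)⟩)
    · exact .inr (.inr (.inl ⟨a, b, P₁, P₂, P₃, .par R S, (h₁.par S).trans (AC.par_assoc _ _ _),
        (h₂.par S).trans (AC.par_assoc _ _ _)⟩))
    · exact .inr (.inr (.inr ⟨a, P₁, P₂, .par R S, (h₁.par S).trans (AC.par_assoc _ _ _),
        (h₂.par S).trans (AC.par_assoc _ _ _)⟩))
  | congr hP _ hQ ih =>
    rcases ih with ⟨a, P₁, P₂, R, h, h₁, h₂⟩ | ⟨a, b, P₁, P₂, P₃, R, h₁, h₂⟩ |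
      ⟨a, b, P₁, P₂, P₃, R, h₁, h₂⟩ | ⟨a, P₁, P₂, R, h₁, h₂⟩
    · exact .inl ⟨a, P₁, P₂, R, h, hP.trans h₁, hQ.symm.trans h₂⟩
    · exact .inr (.inl ⟨a, b, P₁, P₂, P₃, R, hP.trans h₁, hQ.symm.trans h₂⟩)
    · exact .inr (.inr (.inl ⟨a, b, P₁, P₂, P₃, R, hP.trans h₁, hQ.symm.trans h₂⟩))
    · exact .inr (.inr (.inr ⟨a, P₁, P₂, R, hP.trans h₁, hQ.symm.trans h₂⟩))

/-- A prefix in parallel that takes no part in a congruence can be split off. -/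
theorem AC.cancel_act {X Z R K : Proc N} {M : Cap N} (h : AC (.par X (.act M K)) (.par Z R))
    (hZ : Atom.act M (Quotient.mk _ K) ∉ Z.atoms) :
    ∃ R', AC X (.par Z R') ∧ AC R (.par R' (.act M K)) := by
  have h₁ := h.atoms_eq
  simp only [Proc.atoms] at h₁
  have hR : Atom.act M (Quotient.mk _ K) ∈ R.atoms := by
    have : Atom.act M (Quotient.mk _ K) ∈ Z.atoms + R.atoms := by simp [← h₁]
    exact (Multiset.mem_add.1 this).resolve_left hZ
  obtain ⟨R', hR'⟩ := AC.exists_par_of_mem hR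
  have h₂ := hR'.atoms_eq
  rw [Proc.atoms, Atom.atoms_out] at h₂
  refine ⟨R', .of_atoms_eq ?_, .of_atoms_eq ?_⟩
  · rw [h₂, add_comm X.atoms, add_left_comm] at h₁
    exact add_left_cancel h₁
  · rw [h₂, add_comm]
    rfl

/-- Reductions of a process next to an `open` prefix. -/
theorem Step.par_opn {X K Q : Proc N} {n : N} (h : Step (.par X (.act (.opn n) K)) Q) :
    (∃ X', Step X X' ∧ AC Q (.par X' (.act (.opn n) K))) ∨
    ∃ P₁ P₂, AC X (.par (.amb n P₁) P₂) ∧ AC Q (.par (.par P₁ P₂) K) := by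
  -- A redex `Z` without the prefix leaves it in the passive remainder `R`, so the step is one of
  -- `X` alone.
  have key : ∀ {Z Z' R : Proc N}, Step Z Z' → Atom.act (.opn n) (Quotient.mk _ K) ∉ Z.atoms →
      AC (.par X (.act (.opn n) K)) (.par Z R) → AC Q (.par Z' R) →
      ∃ X', Step X X' ∧ AC Q (.par X' (.act (.opn n) K)) := by
    intro Z Z' R hZ hn h₁ h₂
    obtain ⟨R', hX, hR⟩ := h₁.cancel_act hn
    exact ⟨.par Z' R', .congr hX (hZ.par R') (.refl _),
      h₂.trans ((AC.par_congr (.refl _) hR).trans (AC.par_assoc _ _ _).symm)⟩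
  rcases h.redex with ⟨a, P₁, P₂, R, h, h₁, h₂⟩ | ⟨a, b, P₁, P₂, P₃, R, h₁, h₂⟩ |
      ⟨a, b, P₁, P₂, P₃, R, h₁, h₂⟩ | ⟨a, P₁, P₂, R, h₁, h₂⟩
  · exact .inl (key (h.amb a) (by simp [Proc.atoms]) h₁ h₂)
  · exact .inl (key (.goIn a b P₁ P₂ P₃) (by simp [Proc.atoms]) h₁ h₂)
  · exact .inl (key (.goOut a b P₁ P₂ P₃) (by simp [Proc.atoms]) h₁ h₂)
  · by_cases hn : Atom.act (.opn n) (Quotient.mk _ K) ∈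
        (Proc.par (.act (.opn a) P₁) (.amb a P₂)).atoms
    · simp only [Proc.atoms, Multiset.mem_add, Multiset.mem_singleton, Atom.act.injEq,
        Cap.opn.injEq, reduceCtorEq, or_false] at hn
      obtain ⟨rfl, hK⟩ := hn
      refine .inr ⟨P₂, R, .of_atoms_eq ?_, ?_⟩
      · have := h₁.atoms_eq
        simp only [Proc.atoms] at this
        rw [hK, add_comm X.atoms, add_assoc] at this
        exact add_left_cancel this
      · refine h₂.trans (.trans (.of_atoms_eq ?_)
          (AC.par_congr (.refl (.par P₂ R)) (AC.of_quotient_eq hK).symm))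
        simp only [Proc.atoms]
        abel
    · exact .inl (key (.opn a P₁ P₂) hn h₁ h₂)

variable [DecidableEq N]

theorem Step.fn_subset {P Q : Proc N} (h : Step P Q) : Q.fn ⊆ P.fn := by
  induction h with
  | goIn n m P Q R => intro x; simp only [Proc.fn, Finset.mem_insert, Finset.mem_union]; tauto
  | goOut n m P Q R => intro x; simp only [Proc.fn, Finset.mem_insert, Finset.mem_union]; tauto
  | opn n P Q => intro x; simp only [Proc.fn, Finset.mem_insert, Finset.mem_union]; tauto
  | amb n _ ih => exact Finset.insert_subset_insert _ ih
  | par R _ ih => exact Finset.union_subset_union_left ih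
  | congr h₁ _ h₂ ih => rwa [← h₂.strCong.fn_eq, h₁.strCong.fn_eq]

theorem Exposes.mem_fn {P : Proc N} {m : N} (h : Exposes P m) : m ∈ P.fn := by
  obtain ⟨q, hq⟩ := h
  obtain ⟨R, hR⟩ := AC.exists_par_of_mem hq
  rw [hR.strCong.fn_eq]
  simp [Atom.out, Proc.fn]

/-- An empty ambient with a name unknown to the rest of the process persists. -/
theorem Step.exposes_of_par_amb_nil {W X : Proc N} {m : N} (h : Step (.par W (.amb m .nil)) X)
    (hm : m ∉ W.fn) : Exposes X m := by
  have key : ∀ {Z Z' R : Proc N}, AC (.par W (.amb m .nil)) (.par Z R) → AC X (.par Z' R) →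
      Atom.amb m (Quotient.mk _ .nil) ∉ Z.atoms → Exposes X m := by
    intro Z Z' R h₁ h₂ hZ
    refine .congr h₂.symm ⟨Quotient.mk _ .nil, Multiset.mem_add.2 (.inr ?_)⟩
    have : Atom.amb m (Quotient.mk _ .nil) ∈ (Proc.par Z R).atoms := by
      rw [← h₁.atoms_eq]
      simp [Proc.atoms]
    exact (Multiset.mem_add.1 this).resolve_left hZ
  have nil_ne : ∀ {S : Proc N}, S.atoms ≠ 0 →
      (Quotient.mk (acSetoid N) .nil) ≠ Quotient.mk (acSetoid N) S :=
    fun hS e => hS (AC.of_quotient_eq e).atoms_eq.symm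
  rcases h.redex with ⟨a, P₁, P₂, R, h, h₁, h₂⟩ | ⟨a, b, P₁, P₂, P₃, R, h₁, h₂⟩ |
      ⟨a, b, P₁, P₂, P₃, R, h₁, h₂⟩ | ⟨a, P₁, P₂, R, h₁, h₂⟩
  · refine key h₁ h₂ ?_
    simp only [Proc.atoms, Multiset.mem_singleton, Atom.amb.injEq, not_and]
    intro _
    -- A process that can step has at least one component, so the ambient with the inner step is not
    -- `m[0]`.
    refine nil_ne fun h₀ => ?_
    rcases h.redex with ⟨_, _, _, _, _, h', _⟩ | ⟨_, _, _, _, _, _, h', _⟩ |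
      ⟨_, _, _, _, _, _, h', _⟩ | ⟨_, _, _, _, h', _⟩ <;>
    · have := h'.atoms_eq
      simp [h₀, Proc.atoms] at this
  -- The ambient that is entered stays at top level, so `m` remains exposed in that case without
  -- appeal to freshness.
  · by_cases hb : b = m
    · subst hb
      exact .congr h₂.symm ⟨_, by simp [Proc.atoms]; exact .inl rfl⟩
    · refine key h₁ h₂ ?_
      simp only [Proc.atoms, Multiset.mem_singleton, Atom.amb.injEq, Multiset.mem_add, not_or,
        not_and]
      exact ⟨fun _ => nil_ne (by simp [Proc.atoms]), fun e => absurd e.symm hb⟩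
  · refine key h₁ h₂ ?_
    simp only [Proc.atoms, Multiset.mem_singleton, Atom.amb.injEq, not_and]
    exact fun _ => nil_ne (by simp [Proc.atoms])
  · refine key h₁ h₂ ?_
    simp only [Proc.atoms, Multiset.mem_singleton, Atom.amb.injEq, Multiset.mem_add, not_or,
        not_and, reduceCtorEq, not_false_eq_true, true_and]
    -- Opening `m` would need a prefix `open m` in `W`, where `m` is not free.
    rintro rfl _
    have : Atom.act (.opn m) (Quotient.mk _ P₁) ∈ (Proc.par W (.amb m .nil)).atoms := by
      rw [h₁.atoms_eq]
      simp [Proc.atoms]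
    simp only [Proc.atoms, Multiset.mem_add, Multiset.mem_singleton, reduceCtorEq,
      or_false] at this
    obtain ⟨R, hR⟩ := AC.exists_par_of_mem this
    rw [hR.strCong.fn_eq] at hm
    simp [Atom.out, Proc.fn, Cap.name] at hm

/-- The two reductions of the test for the label `- | open n.T`, without restrictions. -/
theorem Step.open_test {X K Q Y : Proc N} {n m : N} (hm : m ∉ X.fn)
    (h₁ : Step (.par X (.act (.opn n) (.par (.amb m .nil) (.act (.opn m) K)))) Q)
    (hQ : Exposes Q m) (h₂ : Step Q Y) (hY : ¬ Exposes Y m) :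
    ∃ P₁ P₂, AC X (.par (.amb n P₁) P₂) ∧ AC Y (.par (.par P₁ P₂) K) := by
  rcases h₁.par_opn with ⟨X', hX, hQX⟩ | ⟨P₁, P₂, hX, hQP⟩
  · obtain ⟨q, hq⟩ := hQ.congr hQX
    simp only [Proc.atoms, Multiset.mem_add, Multiset.mem_singleton, reduceCtorEq,
      or_false] at hq
    -- If `open n` has not fired, the exposed `m` comes from `X`, but steps create no free names.
    exact absurd (hX.fn_subset (Exposes.mem_fn ⟨q, hq⟩)) hm
  refine ⟨P₁, P₂, hX, ?_⟩
  rw [hX.strCong.fn_eq] at hm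
  have hW : m ∉ (Proc.par P₁ P₂).fn := fun h => hm (by
    simp only [Proc.fn, Finset.mem_union, Finset.mem_insert] at h ⊢
    tauto)
  have h₃ : Step (.par (.par (.par P₁ P₂) (.amb m .nil)) (.act (.opn m) K)) Y :=
    .congr ((AC.par_assoc _ _ _).trans hQP.symm) h₂ (.refl _)
  rcases h₃.par_opn with ⟨X', hX', hYX⟩ | ⟨R₁, R₂, hR, hYR⟩
  · obtain ⟨q, hq⟩ := hX'.exposes_of_par_amb_nil hW
    exact absurd (Exposes.congr hYX.symm ⟨q, Multiset.mem_add.2 (.inl hq)⟩) hY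
  · have h₄ := hR.atoms_eq
    have hmem : Atom.amb m (Quotient.mk _ R₁) ∈
        (Proc.par (.par P₁ P₂) (.amb m .nil)).atoms := by
      rw [h₄]
      simp [Proc.atoms]
    -- The opened ambient must be the `m[0]` of the test, because `m` is not free in `P₁ | P₂`.
    -- Nothing is assumed about `m` in `K`.
    have hR₁ : (Quotient.mk (acSetoid N) R₁) = Quotient.mk (acSetoid N) .nil := by
      rcases Multiset.mem_add.1 hmem with h | h
      · exact absurd (Exposes.mem_fn ⟨_, h⟩) hW
      · simpa [Proc.atoms] using h
    have hR₂ : R₂.atoms = (Proc.par P₁ P₂).atoms := by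
      rw [Proc.atoms, add_comm] at h₄
      simp only [Proc.atoms, hR₁] at h₄
      exact (add_left_cancel h₄).symm
    refine hYR.trans (.of_atoms_eq ?_)
    rw [Proc.atoms, Proc.atoms, (AC.of_quotient_eq hR₁).atoms_eq, hR₂]
    simp [Proc.atoms]

end Atoms
end MA
namespace MA

/-! ### Instances of the co-open transition. -/

section Instances

variable {N : Type*}

theorem XProc.pvars_resAll (A : List N) (E : XProc N) : (XProc.resAll A E).pvars = E.pvars := by
  induction A with
  | nil => rfl
  | cons a A ih => exact ih

theorem fresh_notMem [Infinite N] (s : Finset N) : fresh s ∉ s :=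
  (Infinite.exists_notMem_finset s).choose_spec

variable [DecidableEq N]

theorem Proc.fn_toX (P : Proc N) : P.toX.fn = P.fn := by
  induction P <;> simp_all [Proc.toX, Proc.fn, XProc.fn]

variable [Infinite N]

/-- Instantiation of a pure process is renaming of its free names. -/
theorem StrCong.inst_toX (σ : Subst N) {P : Proc N} {ρ : N → N} (π : Equiv.Perm N)
    (h : ∀ x ∈ P.fn, π x = ρ x) : StrCong (P.toX.inst σ ρ) (P.map π) := by
  induction P generalizing ρ π with
  | nil => exact .refl _
  | amb n P ih =>
    simp only [Proc.toX, XProc.inst, Proc.map, ← h n (Finset.mem_insert_self _ _)]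
    exact (ih π fun x hx => h x (Finset.mem_insert_of_mem hx)).amb _
  | act M P ih =>
    simp only [Proc.toX, XProc.inst, Proc.map,
      ← Cap.map_congr (h M.name (Finset.mem_insert_self _ _))]
    exact (ih π fun x hx => h x (Finset.mem_insert_of_mem hx)).act _
  | res n P ih =>
    simp only [Proc.toX, XProc.inst]
    generalize hS : _ ∪ P.toX.nvars.image σ.name = S
    have hp := fresh_notMem S
    generalize fresh S = p at hp
    have h₀ : ∀ x ∈ P.fn, x ≠ n → π x ≠ p := by
      rintro x hx hxn rfl
      apply hp
      rw [← hS, Finset.mem_union, Finset.mem_union]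
      refine .inl (.inl (Finset.mem_image.2 ⟨x, ?_, ?_⟩))
      · rw [Proc.fn_toX]
        exact Finset.mem_erase.2 ⟨hxn, hx⟩
      · exact (h x (Finset.mem_erase.2 ⟨hxn, hx⟩)).symm
    exact ((ih _ (swap_trans_eq_update h h₀)).res p).trans (StrCong.rename_map h₀).symm
  | par P Q ihP ihQ =>
    exact (ihP π fun x hx => h x (Finset.mem_union_left _ hx)).par_congr
      (ihQ π fun x hx => h x (Finset.mem_union_right _ hx))

/-- The instances of the target of an `open` co-action. -/
theorem StrCong.inst_coOpen (σ : Subst N) {A : List N} {P₁ P₂ : Proc N} {ρ : N → N}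
    (π : Equiv.Perm N) (h : ∀ x ∈ (Proc.resAll A (.par P₁ P₂)).fn, π x = ρ x) :
    StrCong ((XProc.resAll A (.par (.par P₁.toX (.pvar 1)) P₂.toX)).inst σ ρ)
      (.par ((Proc.resAll A (.par P₁ P₂)).map π) (σ.proc 1)) := by
  induction A generalizing ρ π with
  | nil =>
    refine (((inst_toX σ π fun x hx => h x (Finset.mem_union_left _ hx)).par _).par_congr
      (inst_toX σ π fun x hx => h x (Finset.mem_union_right _ hx))).trans ?_
    exact AC.strCong (.of_atoms_eq (add_right_comm _ _ _))
  | cons a A ih =>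
    change StrCong (XProc.inst σ ρ (.res a (XProc.resAll A _))) _
    simp only [XProc.inst]
    generalize hE : XProc.resAll A (.par (.par P₁.toX (.pvar 1)) P₂.toX) = E at ih ⊢
    generalize hS : _ ∪ E.nvars.image σ.name = S
    have hp := fresh_notMem S
    generalize fresh S = p at hp
    -- The variable `X₁` lies in the scope of the binder, so the instantiated binder avoids the free
    -- names of its value; this lets the value leave the scope.
    have hpT : p ∉ (σ.proc 1).fn := by
      intro hpT
      apply hp
      rw [← hS, Finset.mem_union, Finset.mem_union, Finset.mem_biUnion]
      refine .inl (.inr ⟨1, ?_, hpT⟩)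
      simp [← hE, XProc.pvars_resAll, XProc.pvars]
    have hfn : ∀ x, x ∈ E.fn ↔ x ∈ (Proc.resAll A (.par P₁ P₂)).fn := by
      intro x
      rw [← hE]
      clear h ih hS hE
      induction A with
      | nil => simp [XProc.resAll, Proc.resAll, XProc.fn, Proc.fn, Proc.fn_toX]
      | cons b A ih =>
        change x ∈ (XProc.resAll A _).fn.erase b ↔ x ∈ (Proc.resAll A _).fn.erase b
        rw [Finset.mem_erase, Finset.mem_erase, ih]
    have h₀ : ∀ x ∈ (Proc.resAll A (.par P₁ P₂)).fn, x ≠ a → π x ≠ p := by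
      rintro x hx hxa rfl
      apply hp
      rw [← hS, Finset.mem_union, Finset.mem_union]
      exact .inl (.inl (Finset.mem_image.2 ⟨x, Finset.mem_erase.2 ⟨hxa, (hfn x).2 hx⟩,
        (h x (Finset.mem_erase.2 ⟨hxa, hx⟩)).symm⟩))
    refine ((ih _ (swap_trans_eq_update h h₀)).res p).trans ?_
    refine ((StrCong.par_comm _ _).res p).trans ((StrCong.res_par p _ _ hpT).trans ?_)
    exact (StrCong.par_comm _ _).trans ((StrCong.rename_map h₀).symm.par _)

/-- Only the co-open rule has a label of this shape. Capture avoidance puts `T` outside the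
restriction, so no condition relating `A` to `T` remains. -/
theorem transMI_openLabel_iff {n : N} {T X Y : Proc N} :
    TransMI X (openLabel n T) Y ↔
      ∃ A P₁ P₂, n ∉ A ∧ StrCong X (.resAll A (.par (.amb n P₁) P₂)) ∧
        StrCong Y (.par (.resAll A (.par P₁ P₂)) T) := by
  have inst : ∀ (σ : Subst N) (A : List N) (P₁ P₂ : Proc N),
      StrCong ((XProc.resAll A (.par (.par P₁.toX (.pvar 1)) P₂.toX)).subst σ)
        (.par (.resAll A (.par P₁ P₂)) (σ.proc 1)) := by
    intro σ A P₁ P₂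
    have := StrCong.inst_coOpen σ (A := A) (P₁ := P₁) (P₂ := P₂) (ρ := id) (Equiv.refl N)
      fun _ _ => rfl
    rwa [Equiv.coe_refl, Proc.map_id] at this
  constructor
  · rintro ⟨D, E, σ, h, hY, hD⟩
    cases h with
    | coOpen A n' P₁ P₂ hn hX =>
      simp only [XCtx.subst, XProc.subst, XProc.inst, openLabel, Ctx.parL.injEq, Proc.act.injEq,
        Cap.map, id, Cap.opn.injEq, true_and] at hD
      obtain ⟨rfl, rfl⟩ := hD
      exact ⟨A, P₁, P₂, hn, hX, hY.symm.trans (inst σ A P₁ P₂)⟩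
    | _ => simp [XCtx.subst, XProc.subst, XProc.inst, openLabel] at hD
  · rintro ⟨A, P₁, P₂, hn, hX, hY⟩
    exact ⟨_, _, ⟨fun _ => T, fun _ => n⟩, .coOpen A n P₁ P₂ hn hX,
      (inst _ A P₁ P₂).trans hY.symm, rfl⟩

end Instances

/-! ### Soundness and completeness of the test, and its stability. -/

section Tests

theorem exists_injective_avoiding {N : Type*} [Infinite N] (α : Type) [Finite α] (s : Finset N) :
    ∃ f : α → N, f.Injective ∧ ∀ i, f i ∉ s := by
  have : Infinite {x : N // x ∉ s} := s.finite_toSet.infinite_compl.to_subtype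
  obtain ⟨k, ⟨e⟩⟩ := Finite.exists_equiv_fin α
  exact ⟨fun i => Infinite.natEmbedding {x : N // x ∉ s} (e i),
    Subtype.val_injective.comp ((Infinite.natEmbedding _).injective.comp
      (Fin.val_injective.comp e.injective)), fun i =>
      (Infinite.natEmbedding {x : N // x ∉ s} (e i)).2⟩

variable {N : Type*} [DecidableEq N]

theorem exists_body_resAll {A : List N} {P : Proc N} (f : Binder (Proc.resAll A P) → N)
    {ρ : N → N} {m : N} (hm : m ∉ A) (hρ : ρ m = m) :
    ∃ (g : Binder P → N) (ρ' : N → N), ρ' m = m ∧ body (Proc.resAll A P) f ρ = body P g ρ' := by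
  induction A generalizing ρ with
  | nil => exact ⟨f, ρ, hρ, rfl⟩
  | cons a A ih =>
    rw [List.mem_cons, not_or] at hm
    exact ih (fun i => f (some i)) hm.2 ((Function.update_of_ne hm.1 _ _).trans hρ)

/-- An unrestricted `m` keeps its name under every assignment to the binders, fresh or not. The
converse `Exposes.barb` needs the assignment to be fresh. -/
theorem Barb.exposes_body {P : Proc N} {m : N} (h : Barb P m) (f : Binder P → N) :
    Exposes (body P f id) m := by
  obtain ⟨A, Q, R, hm, h⟩ := h
  obtain ⟨σ, hσ⟩ := h.ac_body
  have h₁ := hσ (f ∘ σ.symm) id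
  rw [Function.comp_assoc, Equiv.symm_comp_self] at h₁
  obtain ⟨g, ρ, hρ, h₂⟩ := exists_body_resAll (f ∘ σ.symm) hm (ρ := id) rfl
  refine .congr h₁.symm ?_
  rw [h₂]
  refine ⟨Quotient.mk _ (body Q (fun i => g (.inl i)) ρ), ?_⟩
  simp only [body, Proc.atoms, hρ]
  exact Multiset.mem_add.2 (.inl (Multiset.mem_singleton.2 rfl))

theorem Exposes.barb {P : Proc N} {m : N} {f : Binder P → N} (h : Exposes (body P f id) m)
    (hf : f.Injective) (hP : ∀ i, f i ∉ P.fn) (hm : ∀ i, f i ≠ m) : Barb P m := by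
  obtain ⟨Q, R, hQR⟩ := h.exists_ac
  refine ⟨binderNames P f, Q, R, fun hmem => ?_,
    (StrCong.prenex hf hP).trans (hQR.strCong.resAll _)⟩
  obtain ⟨i, hi⟩ := mem_binderNames.1 hmem
  exact hm i hi

theorem Barb.mem_fn {P : Proc N} {m : N} (h : Barb P m) : m ∈ P.fn := by
  obtain ⟨A, Q, R, hm, h⟩ := h
  rw [h.fn_eq, Proc.mem_fn_resAll]
  exact ⟨hm, by simp [Proc.fn]⟩

theorem BarbedSat.symm {P Q : Proc N} (h : BarbedSat P Q) : BarbedSat Q P := by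
  obtain ⟨R, hR, hPQ⟩ := h
  exact ⟨R, hR, hR.1 _ _ hPQ⟩

theorem BarbedSat.red {P Q P' : Proc N} (h : BarbedSat P Q) (C : Ctx N)
    (hP : Red (C.fill P) P') : ∃ Q', Red (C.fill Q) Q' ∧ BarbedSat P' Q' := by
  obtain ⟨R, hR, hPQ⟩ := h
  obtain ⟨Q', hQ, hPQ'⟩ := (hR.2 _ _ hPQ C).2 _ hP
  exact ⟨Q', hQ, R, hR, hPQ'⟩

theorem BarbedSat.barb {P Q : Proc N} {o : N} (h : BarbedSat P Q) (hP : Barb P o) :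
    Barb Q o := by
  obtain ⟨R, hR, hPQ⟩ := h
  exact (hR.2 _ _ hPQ .hole).1 o hP

variable [Infinite N]

/-- A co-open interaction under restrictions, whose names may clash with the other process. -/
theorem Red.open_resAll {A : List N} {n : N} {P₁ P₂ : Proc N} (K : Proc N) (hn : n ∉ A) :
    Red (.par (.resAll A (.par (.amb n P₁) P₂)) (.act (.opn n) K))
      (.par (.resAll A (.par P₁ P₂)) K) := by
  -- Names of `A` may be free in `K`, so each binder is renamed before `K` enters its scope. This
  -- also changes the rest of `A`, hence induction on the length.
  generalize hk : A.length = k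
  induction k generalizing A P₁ P₂ with
  | zero =>
    rw [List.length_eq_zero_iff] at hk
    subst hk
    refine .congr (AC.strCong (.of_atoms_eq ?_)) ((Red.opn n K P₁).par P₂)
      (AC.strCong (.of_atoms_eq ?_)) <;>
    · simp only [Proc.resAll, List.foldr_nil, Proc.atoms]
      abel
  | succ k ih =>
    obtain ⟨a, A, rfl⟩ := List.exists_cons_of_length_eq_add_one hk
    obtain ⟨p, hp⟩ := Infinite.exists_notMem_finset (insert n (K.fn ∪
      (Proc.resAll A (.par (.amb n P₁) P₂)).fn ∪ (Proc.resAll A (.par P₁ P₂)).fn))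
    simp only [Finset.mem_insert, Finset.mem_union, not_or] at hp
    obtain ⟨hpn, ⟨hpK, hpP⟩, hpQ⟩ := hp
    rw [List.mem_cons, not_or] at hn
    have hswap : Equiv.swap a p n = n := Equiv.swap_apply_of_ne_of_ne hn.1 (Ne.symm hpn)
    have aux : ∀ {Z L : Proc N}, p ∉ Z.fn → p ∉ L.fn →
        StrCong (.par (.res a Z) L) (.res p (.par (Z.map (Equiv.swap a p)) L)) := by
      intro Z L hZ hL
      refine ((StrCong.alpha a p Z hZ).par L).trans ((StrCong.par_comm _ _).trans ?_)
      exact (StrCong.res_par p _ _ hL).symm.trans ((StrCong.par_comm _ _).res p)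
    refine .congr (aux hpP ?_) (.res p ?_) (aux hpQ hpK).symm
    · simp [Proc.fn, Cap.name, hpn, hpK]
    · change Red (.par ((Proc.resAll A _).map _) _) (.par ((Proc.resAll A _).map _) _)
      rw [Proc.map_resAll, Proc.map_resAll]
      simp only [Proc.map, hswap]
      refine ih (fun h => ?_) (by simpa using hk)
      obtain ⟨b, hb, hbn⟩ := List.mem_map.1 h
      rw [← hswap] at hbn
      exact hn.2 ((Equiv.injective _ hbn) ▸ hb)

/-- Soundness of the test for the label `- | open n.T`. -/
theorem OpenPred.split {n : N} {T X Y : Proc N} (h : OpenPred n T X Y) :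
    ∃ A P₁ P₂, n ∉ A ∧ StrCong X (.resAll A (.par (.amb n P₁) P₂)) ∧
      StrCong Y (.par (.resAll A (.par P₁ P₂)) T) := by
  obtain ⟨Z, m, hm, h₁, hZ, h₂, hY⟩ := h
  obtain ⟨σ₁, hσ₁⟩ := h₁.step_body
  obtain ⟨σ₂, hσ₂⟩ := h₂.step_body
  have := Binder.finite Y
  obtain ⟨f, hf, hfs⟩ := exists_injective_avoiding (Binder Y)
    (insert n (insert m (X.fn ∪ Y.fn ∪ T.fn)))
  simp only [Finset.mem_insert, Finset.mem_union, not_or] at hfs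
  -- The test adds no binder to those of `X` and `T`. Names are chosen once, for the binders of `Y`,
  -- and pulled back along both reductions.
  let e : Binder X ⊕ Binder T ≃ Binder Y :=
    (Equiv.sumCongr (Equiv.refl _) (Equiv.emptySum Empty _).symm).trans (σ₁.trans σ₂)
  have hfe : (f ∘ e).Injective := hf.comp e.injective
  have hX := StrCong.prenex (P := X) (f := fun i => f (e (.inl i)))
    (hfe.comp Sum.inl_injective) fun i => (hfs _).2.2.1.1
  have hT := StrCong.prenex (P := T) (f := fun i => f (e (.inr i)))
    (hfe.comp Sum.inr_injective) fun i => (hfs _).2.2.2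
  have hY' := StrCong.prenex hf fun i => (hfs i).2.2.1.2
  have hperm : (binderNames X (fun i => f (e (.inl i))) ++
      binderNames T (fun i => f (e (.inr i)))).Perm (binderNames Y f) :=
    binderNames_perm (P := .par X T) e hf
  have hmX : m ∉ (body X (fun i => f (e (.inl i))) id).fn := by
    intro h
    rcases mem_fn_body h with ⟨y, hy, rfl⟩ | ⟨i, hi⟩
    · exact hm hy
    · exact (hfs _).2.1 hi
  have hstep₁ : Step (.par (body X (fun i => f (e (.inl i))) id) (.act (.opn n)
      (.par (.amb m .nil) (.act (.opn m) (body T (fun i => f (e (.inr i))) id)))))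
      (body Z (f ∘ σ₂) id) := hσ₁ (f ∘ σ₂) id
  obtain ⟨P₁, P₂, hXP, hYP⟩ := Step.open_test hmX hstep₁ (hZ.exposes_body _) (hσ₂ f id)
    fun h => hY (h.barb hf (fun i => (hfs i).2.2.1.2) fun i => (hfs i).2.1)
  refine ⟨_, P₁, P₂, fun h => ?_, hX.trans (hXP.strCong.resAll _), ?_⟩
  · obtain ⟨i, hi⟩ := mem_binderNames.1 h
    exact (hfs _).1 hi
  · refine hY'.trans ((StrCong.resAll_perm hperm.symm _).trans ?_)
    refine (hYP.strCong.resAll _).trans (.trans ?_ (hT.symm.par_left _))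
    refine (StrCong.par_resAll_resAll ?_ ?_).symm
    · intro a ha
      obtain ⟨i, rfl⟩ := mem_binderNames.1 ha
      rw [← hT.fn_eq]
      exact (hfs _).2.2.2
    · intro a ha ha'
      obtain ⟨i, rfl⟩ := mem_binderNames.1 ha
      -- A name given to a binder of `T` cannot occur in the body of `X`, so the restrictions from
      -- `T` can be moved back around `T` alone.
      have hmem : f (e (.inr i)) ∈ (body X (fun i => f (e (.inl i))) id).fn := by
        rw [hXP.strCong.fn_eq]
        simp only [Proc.fn, Finset.mem_union, Finset.mem_insert] at ha' ⊢
        tauto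
      rcases mem_fn_body hmem with ⟨y, hy, hyi⟩ | ⟨j, hj⟩
      · exact (hfs (e (.inr i))).2.2.1.1 (hyi ▸ hy)
      · cases e.injective (hf hj)

/-- The test for the label `- | open n.T` succeeds with every sufficiently fresh name. -/
theorem open_test_of_split {n m : N} {T X Y : Proc N} {A : List N} {P₁ P₂ : Proc N} (hn : n ∉ A)
    (hX : StrCong X (.resAll A (.par (.amb n P₁) P₂)))
    (hY : StrCong Y (.par (.resAll A (.par P₁ P₂)) T)) (hmY : m ∉ Y.fn) :
    ∃ Z, Red ((openLabel n (.par (.amb m .nil) (.act (.opn m) T))).fill X) Z ∧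
      Barb Z m ∧ Red Z Y ∧ ¬ Barb Y m := by
  refine ⟨.par (.resAll A (.par P₁ P₂)) (.par (.amb m .nil) (.act (.opn m) T)),
    .congr (hX.par _) (.open_resAll _ hn) (.refl _),
    ⟨[], .nil, .par (.resAll A (.par P₁ P₂)) (.act (.opn m) T), List.not_mem_nil, ?_⟩,
    .congr (AC.strCong (.of_atoms_eq ?_)) ((Red.opn m T .nil).par (.resAll A (.par P₁ P₂)))
      (.trans (AC.strCong (.of_atoms_eq ?_)) hY.symm), fun h => hmY h.mem_fn⟩
  · refine AC.strCong (.of_atoms_eq ?_)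
    simp only [Proc.resAll, List.foldr_nil, Proc.atoms]
    abel
  · simp only [Proc.atoms]
    abel
  · simp only [Proc.atoms]
    abel

theorem openPred_iff_transMI {n : N} {T X Y : Proc N} :
    OpenPred n T X Y ↔ TransMI X (openLabel n T) Y := by
  rw [transMI_openLabel_iff]
  refine ⟨OpenPred.split, fun ⟨A, P₁, P₂, hn, hX, hY⟩ => ?_⟩
  -- Freshness for `X` is what the predicate demands; freshness for `Y` excludes the final barb.
  obtain ⟨m, hm⟩ := Infinite.exists_notMem_finset (X.fn ∪ Y.fn)
  rw [Finset.mem_union, not_or] at hm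
  obtain ⟨Z, h⟩ := open_test_of_split hn hX hY hm.2
  exact ⟨Z, m, hm.1, h⟩

theorem stableUnder_openPred (n : N) (T : Proc N) : StableUnder BarbedSat (OpenPred n T) := by
  intro P Q P' hPQ hP
  obtain ⟨A, P₁, P₂, hn, hX, hY⟩ := hP.split
  -- The new test name must be fresh for `Q`, the process to be tested next, and for `P'`, to
  -- exclude its barb; it may be free in `P`.
  obtain ⟨m, hm⟩ := Infinite.exists_notMem_finset (Q.fn ∪ P'.fn)
  rw [Finset.mem_union, not_or] at hm
  obtain ⟨Z, h₁, hZ, h₂, hP'⟩ := open_test_of_split hn hX hY hm.2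
  obtain ⟨W, hQW, hZW⟩ := hPQ.red _ h₁
  obtain ⟨Q', hWQ, hPQ'⟩ := hZW.red .hole h₂
  exact ⟨Q', ⟨W, m, hm.1, hQW, hZW.barb hZ, hWQ, fun h => hP' (hPQ'.symm.barb h)⟩, hPQ'⟩

end Tests
end MA

theorem mainTheorem5 {N : Type*} [DecidableEq N] [Infinite N] (n : N) (T₁ : MA.Proc N) :
    MA.StableUnder MA.BarbedSat (MA.OpenPred n T₁) ∧
    ∀ P P' : MA.Proc N,
      MA.OpenPred n T₁ P P' ↔ MA.TransMI P (MA.openLabel n T₁) P' :=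
  ⟨MA.stableUnder_openPred n T₁, fun _ _ => MA.openPred_iff_transMI⟩
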